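/- A numerical semigroup is a set $S\subseteq\mathbb N=\{0,1,2,\dots\}$ that contains $0$ and is closed under addition (cofiniteness is not required); $S_1+S_2=\{a+b: a\in S_1,\ b\in S_2\}$. A pointed rational polyhedral cone in $\mathbb R^m$ is a set of the form $\{\sum_{i=1}^{\ell}\lambda_i v_i:\lambda_i\in\mathbb R_{\ge0}\}$ with $v_1,\dots,v_\ell\in\mathbb Z^m$ that contains no line; its dimension is the dimension of its linear span, and its extreme rays are its one-dimensional faces. Say that $(C,\pi)$ represents $S$ if $C\subseteq\mathbb R^m$ is a pointed rational polyhedral cone for some $m \ge 0$, $\pi:\mathbb R^m\to\mathbb R$ is a linear map with integer coefficients, $\pi(C)\subseteq\mathbb R_{\ge0}$, and $S=\pi(C\cap\mathbb Z^m)$. For an integer $k\ge0$, $S$ is $k$-normalescent if it is represented by some $(C,\pi)$ with $\dim C=k$, and $k$-ray-normalescent if it is represented by some $(C,\pi)$ where $C$ has exactly $k$ extreme rays. Finally, $S$ is a $k$-quotient if there are positive integers $d,a_1,\dots,a_k$ with $S=\{t\in\mathbb N: dt\in\langle a_1,\dots,a_k\rangle\}$, where $\langle a_1,\dots,a_k\rangle=\{\sum_i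 a_ix_i:x_i\in\mathbb N\}$. Theorem. Let $S_1,S_2$ be numerical semigroups and $k_1,k_2\ge0$ integers. 1. If $S_1$ is $k_1$-normalescent and $S_2$ is $k_2$-normalescent, then $S_1+S_2$ is $(k_1+k_2)$-normalescent. 2. If $S_1$ is $k_1$-ray-normalescent and $S_2$ is $k_2$-ray-normalescent, then $S_1+S_2$ is $(k_1+k_2)$-ray-normalescent. 3. More precisely, if $(C_1,\pi_1)$ represents $S_1$ and $(C_2,\pi_2)$ represents $S_2$, where $C_i\subseteq\mathbb R^{m_i}$, then the product cone $C_1\times C_2\subseteq\mathbb R^{m_1+m_2}$ together with $\pi(x_1,x_2)=\pi_1(x_1)+\pi_2(x_2)$ represents $S_1+S_2$; moreover $\dim(C_1\times C_2)=\dim C_1+\dim C_2$, and the number of extreme rays of $C_1\times C_2$ is the sum of the numbers of extreme rays of $C_1$ and of $C_2$. 4. If $S_1$ is a $k_1$-quotient and $S_2$ is a $k_2$-quotient, then $S_1+S_2$ is a $(k_1+k_2)$-quotient. -/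

import Mathlib

namespace NumSgp

/-- A numerical semigroup is an additive submonoid of `ℕ` (it is not required to be cofinite).
`sum S₁ S₂` is the numerical semigroup `S₁ + S₂ = {a + b : a ∈ S₁, b ∈ S₂}`. -/
def sum (S₁ S₂ : AddSubmonoid ℕ) : AddSubmonoid ℕ where
  carrier := {s | ∃ a ∈ S₁, ∃ b ∈ S₂, a + b = s}
  zero_mem' := ⟨0, S₁.zero_mem, 0, S₂.zero_mem, rfl⟩
  add_mem' := by
    rintro _ _ ⟨a, ha, b, hb, rfl⟩ ⟨c, hc, d, hd, rfl⟩
    exact ⟨a + c, S₁.add_mem ha hc, b + d, S₂.add_mem hb hd, by ring⟩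

/-- The numerical semigroup `⟨a₁, …, a_k⟩`. -/
def gen {k : ℕ} (a : Fin k → ℕ) : AddSubmonoid ℕ :=
  AddSubmonoid.closure (Set.range a)

/-- The quotient `S / d = {t ∈ ℕ : d t ∈ S}`. -/
def quot (S : AddSubmonoid ℕ) (d : ℕ) : AddSubmonoid ℕ where
  carrier := {t | d * t ∈ S}
  zero_mem' := by simp
  add_mem' := by
    intro s t hs ht
    simpa only [Set.mem_ofPred_eq, mul_add] using S.add_mem hs ht

/-- `S` is a `k`-quotient: `S = ⟨a₁, …, a_k⟩ / d` for positive integers `d, a₁, …, a_k`. -/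
def IsKQuotient (k : ℕ) (S : AddSubmonoid ℕ) : Prop :=
  ∃ (d : ℕ) (a : Fin k → ℕ), 0 < d ∧ (∀ i, 0 < a i) ∧ S = quot (gen a) d

/-- The integer points of `ℝ^m`. -/
def intPoints (m : ℕ) : Set (Fin m → ℝ) :=
  {x | ∃ z : Fin m → ℤ, x = fun i => (z i : ℝ)}

/-- A pointed rational polyhedral cone in `ℝ^m`: the set of nonnegative real combinations of
finitely many integer vectors, containing no line. (In Mathlib a `PointedCone` is a convex cone
containing the origin; a cone that contains no line is called salient.) -/
def IsPointedRationalPolyhedral {m : ℕ} (C : PointedCone ℝ (Fin m → ℝ)) : Prop :=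
  (∃ V : Set (Fin m → ℝ), V.Finite ∧ V ⊆ intPoints m ∧ C = PointedCone.hull ℝ V) ∧
    (C : ConvexCone ℝ (Fin m → ℝ)).Salient

/-- The dimension of a cone: the dimension of its real linear span. -/
noncomputable def dim {m : ℕ} (C : PointedCone ℝ (Fin m → ℝ)) : ℕ :=
  Module.finrank ℝ (Submodule.span ℝ (C : Set (Fin m → ℝ)))

/-- The extreme rays of a cone: its one-dimensional faces. -/
def extremeRays {m : ℕ} (C : PointedCone ℝ (Fin m → ℝ)) :
    Set (PointedCone ℝ (Fin m → ℝ)) :=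
  {F | F.IsFaceOf C ∧ dim F = 1}

/-- A linear form on `ℝ^m` with integer coefficients. -/
def HasIntCoeffs {m : ℕ} (π : (Fin m → ℝ) →ₗ[ℝ] ℝ) : Prop :=
  ∃ c : Fin m → ℤ, ∀ x, π x = ∑ i, (c i : ℝ) * x i

/-- `S = π(C ∩ ℤ^m)`, where `C ⊆ ℝ^m` is a pointed rational polyhedral cone and
`π : ℝ^m → ℝ` is a linear map with integer coefficients such that `π(C) ⊆ ℝ_{≥ 0}`. -/
def IsProjection {m : ℕ} (C : PointedCone ℝ (Fin m → ℝ)) (π : (Fin m → ℝ) →ₗ[ℝ] ℝ)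
    (S : AddSubmonoid ℕ) : Prop :=
  IsPointedRationalPolyhedral C ∧ HasIntCoeffs π ∧ (∀ x ∈ C, 0 ≤ π x) ∧
    (fun n : ℕ => (n : ℝ)) '' (S : Set ℕ) = π '' ((C : Set (Fin m → ℝ)) ∩ intPoints m)

/-- `S` is `k`-normalescent: it is the projection of the integer points of a `k`-dimensional
cone. -/
def IsNormalescent (k : ℕ) (S : AddSubmonoid ℕ) : Prop :=
  ∃ (m : ℕ) (C : PointedCone ℝ (Fin m → ℝ)) (π : (Fin m → ℝ) →ₗ[ℝ] ℝ),
    IsProjection C π S ∧ dim C = k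

/-- `S` is `k`-ray-normalescent: it is the projection of the integer points of a cone with
exactly `k` extreme rays. -/
def IsRayNormalescent (k : ℕ) (S : AddSubmonoid ℕ) : Prop :=
  ∃ (m : ℕ) (C : PointedCone ℝ (Fin m → ℝ)) (π : (Fin m → ℝ) →ₗ[ℝ] ℝ),
    IsProjection C π S ∧ (extremeRays C).encard = k

/-- The coordinate projection `(x₁, x₂) ↦ x₁` from `ℝ^(m₁ + m₂)` to `ℝ^m₁`. -/
def fstProj (m₁ m₂ : ℕ) : (Fin (m₁ + m₂) → ℝ) →ₗ[ℝ] (Fin m₁ → ℝ) :=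
  LinearMap.funLeft ℝ ℝ (Fin.castAdd m₂)

/-- The coordinate projection `(x₁, x₂) ↦ x₂` from `ℝ^(m₁ + m₂)` to `ℝ^m₂`. -/
def sndProj (m₁ m₂ : ℕ) : (Fin (m₁ + m₂) → ℝ) →ₗ[ℝ] (Fin m₂ → ℝ) :=
  LinearMap.funLeft ℝ ℝ (Fin.natAdd m₁)

/-- The product cone `{(x₁, x₂) : x₁ ∈ C₁, x₂ ∈ C₂}` in `ℝ^(m₁ + m₂)`. -/
def prodCone {m₁ m₂ : ℕ} (C₁ : PointedCone ℝ (Fin m₁ → ℝ)) (C₂ : PointedCone ℝ (Fin m₂ → ℝ)) :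
    PointedCone ℝ (Fin (m₁ + m₂) → ℝ) :=
  C₁.comap (fstProj m₁ m₂) ⊓ C₂.comap (sndProj m₁ m₂)

/-- The sum of projections `(x₁, x₂) ↦ π₁(x₁) + π₂(x₂)`. -/
def sumProj {m₁ m₂ : ℕ} (π₁ : (Fin m₁ → ℝ) →ₗ[ℝ] ℝ) (π₂ : (Fin m₂ → ℝ) →ₗ[ℝ] ℝ) :
    (Fin (m₁ + m₂) → ℝ) →ₗ[ℝ] ℝ :=
  π₁ ∘ₗ fstProj m₁ m₂ + π₂ ∘ₗ sndProj m₁ m₂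

end NumSgp

/-! For cones everything is read off the product: integer points, generators, linear spans and faces
of `prodCone C₁ C₂` split along the two factors. A face of dimension 1 is a product of faces whose
dimensions add to 1, so it is an extreme ray of one factor times the zero face of the other;
salience makes zero a face (`bot_isFaceOf`).

For quotients, if `d₁` and `d₂` are coprime, then `⟨a⟩/d₁ + ⟨b⟩/d₂ = ⟨d₂ a, d₁ b⟩/(d₁ d₂)`. The work
is to make the denominators coprime. When the `a j` have gcd 1, the quotient contains all large
integers, so only finitely many `t` matter, and `quot_gen_perturb` replaces `d` by `N * d + a i` for
a suitable large `N`. A good choice of `N` removes a prime shared by `d` and `e` without adding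
another. A common factor of the generators is split off first and put back at the end. -/

namespace NumSgp

/-! ### Quotients of numerical semigroups and their denominators -/

section Quotient

variable {k : ℕ}

theorem mem_gen {a : Fin k → ℕ} {t : ℕ} : t ∈ gen a ↔ ∃ x : Fin k → ℕ, ∑ i, x i * a i = t := by
  simp only [gen, AddSubmonoid.mem_closure_range_iff_of_fintype, smul_eq_mul, eq_comm]

theorem mem_quot {S : AddSubmonoid ℕ} {d t : ℕ} : t ∈ quot S d ↔ d * t ∈ S := Iff.rfl

theorem mem_sum {S₁ S₂ : AddSubmonoid ℕ} {t : ℕ} :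
    t ∈ sum S₁ S₂ ↔ ∃ a ∈ S₁, ∃ b ∈ S₂, a + b = t := Iff.rfl

theorem mem_gen_mul {a : Fin k → ℕ} {c t : ℕ} :
    t ∈ gen (fun i => c * a i) ↔ ∃ s ∈ gen a, c * s = t := by
  simp only [mem_gen, exists_exists_eq_and, Finset.mul_sum]
  simp only [mul_left_comm]

theorem mem_gen_append {k₁ k₂ : ℕ} {a : Fin k₁ → ℕ} {b : Fin k₂ → ℕ} {t : ℕ} :
    t ∈ gen (Fin.append a b) ↔ ∃ r ∈ gen a, ∃ s ∈ gen b, r + s = t := by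
  simp only [mem_gen, exists_exists_eq_and, Fin.sum_univ_add, Fin.append_left, Fin.append_right]
  constructor
  · rintro ⟨x, hx⟩
    exact ⟨_, _, hx⟩
  · rintro ⟨x, y, h⟩
    exact ⟨Fin.append x y, by simpa using h⟩

/-- Generators `a` without common factor represent every large integer, hence so do the
elements of any quotient. -/
theorem exists_forall_ge_mem_quot {a : Fin k → ℕ} (ha : Finset.univ.gcd a = 1) {d : ℕ}
    (hd : 0 < d) : ∃ T, ∀ t ≥ T, t ∈ quot (gen a) d := by
  obtain ⟨T, hT⟩ := Nat.exists_mem_closure_of_ge (Set.range a)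
  refine ⟨T, fun t ht => hT _ (ht.trans (Nat.le_mul_of_pos_left t hd)) ?_⟩
  have h : Nat.setGcd (Set.range a) ∣ Finset.univ.gcd a :=
    Finset.dvd_gcd fun i _ => Nat.setGcd_dvd_of_mem ⟨i, rfl⟩
  rw [ha] at h
  exact h.trans (one_dvd _)

theorem sum_update_mul (x a : Fin k → ℕ) (i : Fin k) (y : ℕ) :
    ∑ j, Function.update x i y j * a j = y * a i + ∑ j ∈ Finset.univ.erase i, x j * a j := by
  rw [← Finset.add_sum_erase _ _ (Finset.mem_univ i), Function.update_self]
  congr 1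
  refine Finset.sum_congr rfl fun j hj => ?_
  rw [Function.update_of_ne (Finset.ne_of_mem_erase hj)]

/-- Scaling all generators but one by a large factor `N` and moving the denominator accordingly
does not change the quotient: it enlarges the underlying cone only slightly. -/
theorem quot_gen_perturb {a : Fin k → ℕ} {d T N : ℕ} (i : Fin k)
    (hT : ∀ t ≥ T, t ∈ quot (gen a) d) (hTN : T < N) (hN : N.Coprime (a i)) :
    quot (gen (Function.update (fun j => N * a j) i (a i))) (N * d + a i) = quot (gen a) d := by
  have key (x : Fin k → ℕ) : ∑ j, x j * Function.update (fun j => N * a j) i (a i) j =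
      x i * a i + N * ∑ j ∈ Finset.univ.erase i, x j * a j := by
    simp_rw [mul_comm (x _)]
    rw [sum_update_mul, Finset.mul_sum]
    congr 1
    exact Finset.sum_congr rfl fun j _ => by ring
  ext t
  rw [mem_quot, mem_quot, mem_gen, mem_gen]
  constructor
  · rintro ⟨x, hx⟩
    rw [key] at hx
    obtain ht | ht := le_or_gt T t
    · exact mem_gen.1 (hT t ht)
    set R := ∑ j ∈ Finset.univ.erase i, x j * a j with hR
    have hz : ((x i : ℤ) - t) * a i = N * (d * t - R) := by
      have : (x i : ℤ) * a i + N * R = (N * d + a i) * t := by exact_mod_cast hx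
      linear_combination this
    -- This `y` is the coefficient of `a i` in the representation of `d * t`.
    obtain ⟨y, hy⟩ : (N : ℤ) ∣ (x i : ℤ) - t :=
      (Nat.isCoprime_iff_coprime.2 hN).dvd_of_dvd_mul_right ⟨_, hz⟩
    have hN0 : (0 : ℤ) < N := by exact_mod_cast (Nat.zero_le T).trans_lt hTN
    -- Otherwise `x i ≤ t - N < 0`, because `t < T < N`.
    have hy0 : 0 ≤ y := by
      by_contra! h
      have h1 : (N : ℤ) * y ≤ N * (-1) := mul_le_mul_of_nonneg_left (by omega) hN0.le
      omega
    lift y to ℕ using hy0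
    refine ⟨Function.update x i y, ?_⟩
    rw [sum_update_mul, ← hR]
    rw [hy, mul_assoc] at hz
    have := mul_left_cancel₀ hN0.ne' hz
    zify
    linear_combination this
  · rintro ⟨x, hx⟩
    -- The extra summand `a i * t` of the new left side is absorbed by `t` more copies of `a i`.
    refine ⟨Function.update x i (N * x i + t), ?_⟩
    rw [key, Function.update_self]
    rw [← Finset.add_sum_erase _ _ (Finset.mem_univ i)] at hx
    have : ∑ j ∈ Finset.univ.erase i, Function.update x i (N * x i + t) j * a j =
        ∑ j ∈ Finset.univ.erase i, x j * a j :=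
      Finset.sum_congr rfl fun j hj => by rw [Function.update_of_ne (Finset.ne_of_mem_erase hj)]
    rw [this]
    linear_combination (N : ℕ) * hx

/-- A quotient by generators without common factor can be rewritten with a denominator coprime
to any prescribed number. -/
theorem exists_coprime_denominator_of_gcd_eq_one {e : ℕ} (he : e ≠ 0) {a : Fin k → ℕ} {d : ℕ}
    (hd : 0 < d) (ha : ∀ i, 0 < a i) (hgcd : Finset.univ.gcd a = 1) :
    ∃ (d' : ℕ) (a' : Fin k → ℕ), 0 < d' ∧ (∀ i, 0 < a' i) ∧ d'.Coprime e ∧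
      quot (gen a') d' = quot (gen a) d := by
  -- Each perturbation strictly shrinks the set of primes common to `d` and `e`.
  induction hn : (d.primeFactors ∩ e.primeFactors).card using Nat.strong_induction_on
    generalizing a d with
  | _ n ih =>
    by_cases hde : d.Coprime e
    · exact ⟨d, a, hd, ha, hde, rfl⟩
    obtain ⟨p, hp, hpd, hpe⟩ := Nat.Prime.not_coprime_iff_dvd.1 hde
    obtain ⟨i, hi⟩ : ∃ i, ¬ p ∣ a i := by
      by_contra! h
      have := Finset.dvd_gcd (s := Finset.univ) (f := a) fun i _ => h i
      rw [hgcd] at this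
      exact hp.one_lt.ne' (Nat.dvd_one.1 this)
    obtain ⟨T, hT⟩ := exists_forall_ge_mem_quot hgcd hd
    -- Every prime of `e` thus divides exactly one of `M` and `a i`.
    set M := ∏ q ∈ e.primeFactors with ¬ q ∣ a i, q with hM
    have hMdvd {q : ℕ} (hq : q.Prime) (hqe : q ∣ e) (hqa : ¬ q ∣ a i) : q ∣ M :=
      Finset.dvd_prod_of_mem (fun q => q)
        (Finset.mem_filter.2 ⟨Nat.mem_primeFactors.2 ⟨hq, hqe, he⟩, hqa⟩)
    have hMa : M.Coprime (a i) := Nat.Coprime.prod_left fun q hq =>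
      ((Nat.prime_of_mem_primeFactors (Finset.mem_filter.1 hq).1).coprime_iff_not_dvd).2
        (Finset.mem_filter.1 hq).2
    have hM0 : 0 < M := Finset.prod_pos fun q hq =>
      (Nat.prime_of_mem_primeFactors (Finset.mem_filter.1 hq).1).pos
    have hM1 : 1 < M := hp.one_lt.trans_le (Nat.le_of_dvd hM0 (hMdvd hp hpe hi))
    -- The power exceeds `T` and has the same prime divisors as `M`.
    set N := M ^ (T + 1) with hN
    have hTN : T < N := (Nat.lt_succ_self T).trans (Nat.lt_pow_self hM1)
    have hNa : N.Coprime (a i) := hMa.pow_left _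
    have hqN {q : ℕ} (hq : q ∣ M) : q ∣ N := hq.trans (dvd_pow_self M T.succ_ne_zero)
    rw [← quot_gen_perturb i hT hTN hNa]
    refine ih _ ?_ (by have := ha i; omega) ?_ ?_ rfl
    · rw [← hn]
      refine Finset.card_lt_card (Finset.ssubset_iff_of_subset ?_ |>.2 ⟨p, ?_, ?_⟩)
      · intro q hq
        -- If `q ∤ a i`, then `q ∣ N` and `q` cannot divide `N * d + a i`. Hence `q ∣ a i` and `q ∤
        -- N`, which forces `q ∣ d`.
        simp only [Finset.mem_inter, Nat.mem_primeFactors] at hq ⊢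
        obtain ⟨⟨hq, hqd, -⟩, -, hqe, -⟩ := hq
        refine ⟨⟨hq, ?_, hd.ne'⟩, hq, hqe, he⟩
        have hqa : q ∣ a i := by
          by_contra h
          exact h ((Nat.dvd_add_right ((hqN (hMdvd hq hqe h)).mul_right d)).1 hqd)
        refine (hq.dvd_mul.1 ((Nat.dvd_add_left hqa).1 hqd)).resolve_left fun h => ?_
        exact Nat.not_coprime_of_dvd_of_dvd hq.one_lt h hqa hNa
      · simp [hp, hpd, hpe, hd.ne', he]
      · simp only [Finset.mem_inter, Nat.mem_primeFactors, not_and]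
        rintro ⟨-, h, -⟩
        exact absurd ((Nat.dvd_add_right ((hqN (hMdvd hp hpe hi)).mul_right d)).1 h) hi
    · intro j
      obtain rfl | hj := eq_or_ne j i
      · simpa using ha j
      · simpa [Function.update_of_ne hj] using ⟨by omega, ha j⟩
    -- The new gcd divides `a i`, so it is coprime to `N` and divides every `a j`.
    · refine Nat.dvd_one.1 (hgcd ▸ Finset.dvd_gcd fun j _ => ?_)
      have hi' := Finset.gcd_dvd (f := Function.update (fun j => N * a j) i (a i))
        (Finset.mem_univ i)
      have hj' := Finset.gcd_dvd (f := Function.update (fun j => N * a j) i (a i))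
        (Finset.mem_univ j)
      rw [Function.update_self] at hi'
      obtain rfl | hj := eq_or_ne j i
      · exact hi'
      · rw [Function.update_of_ne hj] at hj'
        exact (Nat.Coprime.coprime_dvd_left hi' hNa.symm).dvd_of_dvd_mul_left hj'

/-- A common factor coprime to the denominator passes outside the quotient, since `g ∣ d * t` forces
`g ∣ t`. -/
theorem quot_gen_mul {g d : ℕ} (hg : 0 < g) (h : d.Coprime g) (a : Fin k → ℕ) {t : ℕ} :
    t ∈ quot (gen fun i => g * a i) d ↔ ∃ s ∈ quot (gen a) d, g * s = t := by
  simp only [mem_quot, mem_gen_mul]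
  constructor
  · rintro ⟨s, hs, hst⟩
    obtain ⟨u, rfl⟩ : g ∣ t := h.symm.dvd_of_dvd_mul_left ⟨s, hst.symm⟩
    refine ⟨u, ?_, rfl⟩
    have : s = d * u := Nat.eq_of_mul_eq_mul_left hg (by rw [hst]; ring)
    rwa [← this]
  · rintro ⟨s, hs, rfl⟩
    exact ⟨_, hs, by ring⟩

theorem quot_gen_mul_mul {h d : ℕ} (hh : 0 < h) (a : Fin k → ℕ) :
    quot (gen fun i => h * a i) (h * d) = quot (gen a) d := by
  ext t
  simp only [mem_quot, mem_gen_mul, mul_assoc]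
  constructor
  · rintro ⟨s, hs, hst⟩
    rwa [← Nat.eq_of_mul_eq_mul_left hh hst]
  · exact fun ht => ⟨_, ht, rfl⟩

/-- Every `k`-quotient has a representation whose denominator is coprime to a prescribed
number. -/
theorem IsKQuotient.exists_coprime {S : AddSubmonoid ℕ} (hS : IsKQuotient k S) {e : ℕ}
    (he : e ≠ 0) : ∃ (d : ℕ) (a : Fin k → ℕ), 0 < d ∧ (∀ i, 0 < a i) ∧ d.Coprime e ∧
      S = quot (gen a) d := by
  obtain ⟨d, a, hd, ha, rfl⟩ := hS
  -- The empty family has gcd 0, not a positive one; its quotient is `{0}` for every denominator.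
  obtain rfl | hk := Nat.eq_zero_or_pos k
  · refine ⟨1, a, one_pos, ha, Nat.coprime_one_left e, ?_⟩
    ext t
    simp only [mem_quot, mem_gen, Finset.univ_eq_empty, Finset.sum_empty, exists_const]
    simp [eq_comm (a := 0), hd.ne']
  have i₀ : Fin k := ⟨0, hk⟩
  obtain ⟨b, hb, hb1⟩ := Finset.extract_gcd a (s := Finset.univ) ⟨i₀, Finset.mem_univ i₀⟩
  set g := Finset.univ.gcd a with hg
  have hab : a = fun i => g * b i := funext fun i => hb i (Finset.mem_univ i)
  have hb0 (i) : 0 < b i := Nat.pos_of_ne_zero fun h => by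
    have := ha i; rw [hab] at this; simp [h] at this
  have hg0 : 0 < g := Nat.pos_of_ne_zero fun h => by
    have := ha i₀; rw [hab] at this; simp [h] at this
  obtain ⟨g', d', hcop, hg', hd'⟩ := Nat.exists_coprime g d
  set h := g.gcd d
  have hh : 0 < h := Nat.gcd_pos_of_pos_left _ hg0
  have hg'0 : 0 < g' := Nat.pos_of_ne_zero (by rintro rfl; simp at hg'; omega)
  have hd'0 : 0 < d' := Nat.pos_of_ne_zero (by rintro rfl; simp at hd'; omega)
  -- Coprimality to `g'` as well as to `e` allows `g'` to be moved back inside the quotient.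
  obtain ⟨d'', b', hd'', hb', hcop', hquot⟩ := exists_coprime_denominator_of_gcd_eq_one
    (mul_ne_zero he hg'0.ne') hd'0 hb0 hb1
  refine ⟨d'', fun i => g' * b' i, hd'', fun i => Nat.mul_pos hg'0 (hb' i),
    hcop'.coprime_mul_right_right, ?_⟩
  have : a = fun i => h * (g' * b i) := by
    rw [hab]; funext i; rw [← mul_assoc, mul_comm h, ← hg']
  rw [this, hd', mul_comm d' h, quot_gen_mul_mul hh]
  ext t
  rw [quot_gen_mul hg'0 hcop.symm, quot_gen_mul hg'0 hcop'.coprime_mul_left_right, hquot]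

theorem IsKQuotient.sum {S₁ S₂ : AddSubmonoid ℕ} {k₁ k₂ : ℕ} (h₁ : IsKQuotient k₁ S₁)
    (h₂ : IsKQuotient k₂ S₂) : IsKQuotient (k₁ + k₂) (sum S₁ S₂) := by
  obtain ⟨d₂, b, hd₂, hb, rfl⟩ := h₂
  obtain ⟨d₁, a, hd₁, ha, hcop, rfl⟩ := h₁.exists_coprime hd₂.ne'
  refine ⟨d₁ * d₂, Fin.append (fun i => d₂ * a i) (fun i => d₁ * b i), Nat.mul_pos hd₁ hd₂,
    fun i => ?_, ?_⟩
  · refine Fin.addCases (fun i => ?_) (fun i => ?_) i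
    · simpa using ⟨hd₂, ha i⟩
    · simpa using ⟨hd₁, hb i⟩
  ext t
  simp only [mem_sum, mem_quot, mem_gen_append, mem_gen_mul, exists_exists_and_eq_and]
  constructor
  · rintro ⟨r, hr, s, hs, rfl⟩
    exact ⟨_, hr, _, hs, by ring⟩
  · rintro ⟨A, hA, B, hB, h⟩
    -- Reducing `d₂ * A + d₁ * B = d₁ * d₂ * t` modulo `d₁`, and below modulo `d₂`, splits `t` as `r
    -- + s`.
    obtain ⟨r, rfl⟩ : d₁ ∣ A := hcop.dvd_of_dvd_mul_left
      ((Nat.dvd_add_left (Dvd.intro B rfl)).1 (h ▸ (Dvd.intro _ rfl).mul_right t))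
    obtain ⟨s, rfl⟩ : d₂ ∣ B := hcop.symm.dvd_of_dvd_mul_left
      ((Nat.dvd_add_right (Dvd.intro _ rfl)).1 (h ▸ (Dvd.intro_left _ rfl).mul_right t))
    refine ⟨r, hA, s, hB, Nat.eq_of_mul_eq_mul_left (Nat.mul_pos hd₁ hd₂) ?_⟩
    rw [← h]; ring

end Quotient


/-! ### Product cones and their projections -/

section Product

variable {m m₁ m₂ : ℕ}

@[simp] theorem fstProj_apply (x : Fin (m₁ + m₂) → ℝ) (i : Fin m₁) :
    fstProj m₁ m₂ x i = x (Fin.castAdd m₂ i) := rfl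

@[simp] theorem sndProj_apply (x : Fin (m₁ + m₂) → ℝ) (i : Fin m₂) :
    sndProj m₁ m₂ x i = x (Fin.natAdd m₁ i) := rfl

/-- The inclusion `x ↦ (x, 0)` of `ℝ^m₁` into `ℝ^(m₁ + m₂)`. -/
def inlMap (m₁ m₂ : ℕ) : (Fin m₁ → ℝ) →ₗ[ℝ] (Fin (m₁ + m₂) → ℝ) where
  toFun x := Fin.append x 0
  map_add' x y := by
    ext i; refine Fin.addCases (fun i => ?_) (fun i => ?_) i <;> simp
  map_smul' c x := by
    ext i; refine Fin.addCases (fun i => ?_) (fun i => ?_) i <;> simp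

/-- The inclusion `x ↦ (0, x)` of `ℝ^m₂` into `ℝ^(m₁ + m₂)`. -/
def inrMap (m₁ m₂ : ℕ) : (Fin m₂ → ℝ) →ₗ[ℝ] (Fin (m₁ + m₂) → ℝ) where
  toFun x := Fin.append 0 x
  map_add' x y := by
    ext i; refine Fin.addCases (fun i => ?_) (fun i => ?_) i <;> simp
  map_smul' c x := by
    ext i; refine Fin.addCases (fun i => ?_) (fun i => ?_) i <;> simp

@[simp] theorem fstProj_inlMap (x : Fin m₁ → ℝ) : fstProj m₁ m₂ (inlMap m₁ m₂ x) = x := by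
  ext i; simp [inlMap]

@[simp] theorem sndProj_inlMap (x : Fin m₁ → ℝ) : sndProj m₁ m₂ (inlMap m₁ m₂ x) = 0 := by
  ext i; simp [inlMap]

@[simp] theorem fstProj_inrMap (x : Fin m₂ → ℝ) : fstProj m₁ m₂ (inrMap m₁ m₂ x) = 0 := by
  ext i; simp [inrMap]

@[simp] theorem sndProj_inrMap (x : Fin m₂ → ℝ) : sndProj m₁ m₂ (inrMap m₁ m₂ x) = x := by
  ext i; simp [inrMap]

theorem inlMap_add_inrMap (x : Fin (m₁ + m₂) → ℝ) :
    inlMap m₁ m₂ (fstProj m₁ m₂ x) + inrMap m₁ m₂ (sndProj m₁ m₂ x) = x := by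
  ext i; refine Fin.addCases (fun i => ?_) (fun i => ?_) i <;> simp [inlMap, inrMap]

theorem eq_of_proj_eq {x y : Fin (m₁ + m₂) → ℝ} (h₁ : fstProj m₁ m₂ x = fstProj m₁ m₂ y)
    (h₂ : sndProj m₁ m₂ x = sndProj m₁ m₂ y) : x = y := by
  rw [← inlMap_add_inrMap x, h₁, h₂, inlMap_add_inrMap]

theorem inlMap_injective : Function.Injective (inlMap m₁ m₂) :=
  Function.LeftInverse.injective (g := fstProj m₁ m₂) fstProj_inlMap

theorem inrMap_injective : Function.Injective (inrMap m₁ m₂) :=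
  Function.LeftInverse.injective (g := sndProj m₁ m₂) sndProj_inrMap

theorem mem_intPoints_iff {x : Fin (m₁ + m₂) → ℝ} :
    x ∈ intPoints (m₁ + m₂) ↔
      fstProj m₁ m₂ x ∈ intPoints m₁ ∧ sndProj m₁ m₂ x ∈ intPoints m₂ := by
  constructor
  · rintro ⟨z, rfl⟩
    exact ⟨⟨fun i => z (Fin.castAdd m₂ i), rfl⟩, ⟨fun i => z (Fin.natAdd m₁ i), rfl⟩⟩
  · rintro ⟨⟨z, hz⟩, ⟨w, hw⟩⟩
    refine ⟨Fin.append z w, eq_of_proj_eq ?_ ?_⟩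
    · rw [hz]; ext i; simp
    · rw [hw]; ext i; simp

theorem zero_mem_intPoints : (0 : Fin m → ℝ) ∈ intPoints m := ⟨0, by ext; simp⟩

variable {C F : PointedCone ℝ (Fin m → ℝ)} {C₁ F₁ : PointedCone ℝ (Fin m₁ → ℝ)}
  {C₂ F₂ : PointedCone ℝ (Fin m₂ → ℝ)}

theorem mem_prodCone {x : Fin (m₁ + m₂) → ℝ} :
    x ∈ prodCone C₁ C₂ ↔ fstProj m₁ m₂ x ∈ C₁ ∧ sndProj m₁ m₂ x ∈ C₂ := Iff.rfl

theorem inlMap_mem_prodCone {x : Fin m₁ → ℝ} : inlMap m₁ m₂ x ∈ prodCone C₁ C₂ ↔ x ∈ C₁ := by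
  simp [mem_prodCone]

theorem inrMap_mem_prodCone {x : Fin m₂ → ℝ} : inrMap m₁ m₂ x ∈ prodCone C₁ C₂ ↔ x ∈ C₂ := by
  simp [mem_prodCone]

theorem prodCone_eq_sup (C₁ : PointedCone ℝ (Fin m₁ → ℝ)) (C₂ : PointedCone ℝ (Fin m₂ → ℝ)) :
    prodCone C₁ C₂ = C₁.map (inlMap m₁ m₂) ⊔ C₂.map (inrMap m₁ m₂) := by
  apply le_antisymm
  · intro x hx
    rw [← inlMap_add_inrMap x]
    exact Submodule.add_mem_sup ⟨_, hx.1, rfl⟩ ⟨_, hx.2, rfl⟩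
  · refine sup_le ?_ ?_
    · rintro _ ⟨x, hx, rfl⟩
      exact inlMap_mem_prodCone.2 hx
    · rintro _ ⟨x, hx, rfl⟩
      exact inrMap_mem_prodCone.2 hx

theorem salient_prodCone (h₁ : (C₁ : ConvexCone ℝ (Fin m₁ → ℝ)).Salient)
    (h₂ : (C₂ : ConvexCone ℝ (Fin m₂ → ℝ)).Salient) :
    (prodCone C₁ C₂ : ConvexCone ℝ (Fin (m₁ + m₂) → ℝ)).Salient := by
  rintro x ⟨hx₁, hx₂⟩ hx0 ⟨hn₁, hn₂⟩
  refine hx0 (eq_of_proj_eq ?_ ?_)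
  · by_contra h
    exact h₁ _ hx₁ (by simpa using h) (by simpa using hn₁)
  · by_contra h
    exact h₂ _ hx₂ (by simpa using h) (by simpa using hn₂)

theorem IsPointedRationalPolyhedral.prodCone (h₁ : IsPointedRationalPolyhedral C₁)
    (h₂ : IsPointedRationalPolyhedral C₂) :
    IsPointedRationalPolyhedral (prodCone C₁ C₂) := by
  obtain ⟨⟨V₁, hf₁, hi₁, hC₁⟩, hs₁⟩ := h₁
  obtain ⟨⟨V₂, hf₂, hi₂, hC₂⟩, hs₂⟩ := h₂
  refine ⟨⟨inlMap m₁ m₂ '' V₁ ∪ inrMap m₁ m₂ '' V₂, (hf₁.image _).union (hf₂.image _), ?_, ?_⟩,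
    salient_prodCone hs₁ hs₂⟩
  · rintro _ (⟨v, hv, rfl⟩ | ⟨v, hv, rfl⟩)
    · exact mem_intPoints_iff.2 ⟨by simpa using hi₁ hv, by simpa using zero_mem_intPoints⟩
    · exact mem_intPoints_iff.2 ⟨by simpa using zero_mem_intPoints, by simpa using hi₂ hv⟩
  · rw [prodCone_eq_sup, hC₁, hC₂, PointedCone.hull, PointedCone.hull, PointedCone.hull,
      Submodule.span_union, PointedCone.map, PointedCone.map, Submodule.map_span,
      Submodule.map_span]
    rfl

theorem HasIntCoeffs.sumProj {π₁ : (Fin m₁ → ℝ) →ₗ[ℝ] ℝ} {π₂ : (Fin m₂ → ℝ) →ₗ[ℝ] ℝ}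
    (h₁ : HasIntCoeffs π₁) (h₂ : HasIntCoeffs π₂) : HasIntCoeffs (sumProj π₁ π₂) := by
  obtain ⟨c₁, hc₁⟩ := h₁
  obtain ⟨c₂, hc₂⟩ := h₂
  refine ⟨Fin.append c₁ c₂, fun x => ?_⟩
  simp [NumSgp.sumProj, hc₁, hc₂, Fin.sum_univ_add]

theorem IsProjection.prodCone {S₁ S₂ : AddSubmonoid ℕ} {π₁ : (Fin m₁ → ℝ) →ₗ[ℝ] ℝ}
    {π₂ : (Fin m₂ → ℝ) →ₗ[ℝ] ℝ} (h₁ : IsProjection C₁ π₁ S₁) (h₂ : IsProjection C₂ π₂ S₂) :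
    IsProjection (prodCone C₁ C₂) (sumProj π₁ π₂) (sum S₁ S₂) := by
  obtain ⟨hC₁, hc₁, hp₁, he₁⟩ := h₁
  obtain ⟨hC₂, hc₂, hp₂, he₂⟩ := h₂
  refine ⟨hC₁.prodCone hC₂, hc₁.sumProj hc₂, fun x hx => add_nonneg (hp₁ _ hx.1) (hp₂ _ hx.2), ?_⟩
  ext y
  constructor
  · rintro ⟨_, ⟨a, ha, b, hb, rfl⟩, rfl⟩
    obtain ⟨x₁, ⟨hx₁, hi₁⟩, hxa⟩ := he₁ ▸ Set.mem_image_of_mem (fun n : ℕ => (n : ℝ)) ha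
    obtain ⟨x₂, ⟨hx₂, hi₂⟩, hxb⟩ := he₂ ▸ Set.mem_image_of_mem (fun n : ℕ => (n : ℝ)) hb
    refine ⟨inlMap m₁ m₂ x₁ + inrMap m₁ m₂ x₂, ⟨mem_prodCone.2 ?_, mem_intPoints_iff.2 ?_⟩, ?_⟩
    · simpa using ⟨hx₁, hx₂⟩
    · simpa using ⟨hi₁, hi₂⟩
    · simp [sumProj, hxa, hxb]
  · rintro ⟨x, ⟨hx, hi⟩, rfl⟩
    rw [mem_intPoints_iff] at hi
    obtain ⟨a, ha, hxa⟩ := he₁.symm ▸ Set.mem_image_of_mem π₁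
      (show fstProj m₁ m₂ x ∈ (C₁ : Set _) ∩ intPoints m₁ from ⟨hx.1, hi.1⟩)
    obtain ⟨b, hb, hxb⟩ := he₂.symm ▸ Set.mem_image_of_mem π₂
      (show sndProj m₁ m₂ x ∈ (C₂ : Set _) ∩ intPoints m₂ from ⟨hx.2, hi.2⟩)
    refine ⟨a + b, ⟨a, ha, b, hb, rfl⟩, ?_⟩
    simp only at hxa hxb
    simp [sumProj, ← hxa, ← hxb]

/-! ### Dimension of the product cone -/

theorem dim_map {n : ℕ} {f : (Fin m → ℝ) →ₗ[ℝ] (Fin n → ℝ)} (hf : Function.Injective f)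
    (C : PointedCone ℝ (Fin m → ℝ)) : dim (C.map f) = dim C := by
  rw [dim, dim, PointedCone.coe_map, ← Submodule.map_span]
  exact (Submodule.equivMapOfInjective f hf _).finrank_eq.symm

theorem dim_eq_zero : dim C = 0 ↔ C = ⊥ := by
  rw [dim, Submodule.finrank_eq_zero, Submodule.span_eq_bot, Submodule.eq_bot_iff]
  rfl

theorem dim_prodCone (C₁ : PointedCone ℝ (Fin m₁ → ℝ)) (C₂ : PointedCone ℝ (Fin m₂ → ℝ)) :
    dim (prodCone C₁ C₂) = dim C₁ + dim C₂ := by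
  have hspan : Submodule.span ℝ (prodCone C₁ C₂ : Set (Fin (m₁ + m₂) → ℝ)) =
      (Submodule.span ℝ (C₁ : Set (Fin m₁ → ℝ))).map (inlMap m₁ m₂) ⊔
        (Submodule.span ℝ (C₂ : Set (Fin m₂ → ℝ))).map (inrMap m₁ m₂) := by
    rw [Submodule.map_span, Submodule.map_span, ← Submodule.span_union]
    apply le_antisymm
    · refine Submodule.span_le.2 fun x hx => ?_
      rw [← inlMap_add_inrMap x]
      exact add_mem (Submodule.subset_span (.inl ⟨_, hx.1, rfl⟩))
        (Submodule.subset_span (.inr ⟨_, hx.2, rfl⟩))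
    · refine Submodule.span_mono ?_
      rintro _ (⟨x, hx, rfl⟩ | ⟨x, hx, rfl⟩)
      · exact inlMap_mem_prodCone.2 hx
      · exact inrMap_mem_prodCone.2 hx
  have hinf : (Submodule.span ℝ (C₁ : Set (Fin m₁ → ℝ))).map (inlMap m₁ m₂) ⊓
      (Submodule.span ℝ (C₂ : Set (Fin m₂ → ℝ))).map (inrMap m₁ m₂) = ⊥ := by
    rw [Submodule.eq_bot_iff]
    rintro _ ⟨⟨x, -, rfl⟩, ⟨y, -, hy⟩⟩
    have : x = 0 := by simpa using (congrArg (fstProj m₁ m₂) hy).symm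
    simp [this]
  have h := Submodule.finrank_sup_add_finrank_inf_eq
    ((Submodule.span ℝ (C₁ : Set (Fin m₁ → ℝ))).map (inlMap m₁ m₂))
    ((Submodule.span ℝ (C₂ : Set (Fin m₂ → ℝ))).map (inrMap m₁ m₂))
  rw [← hspan, hinf, finrank_bot, add_zero,
    ← (Submodule.equivMapOfInjective _ inlMap_injective _).finrank_eq,
    ← (Submodule.equivMapOfInjective _ inrMap_injective _).finrank_eq] at h
  exact h

/-! ### Faces and extreme rays of the product cone -/

theorem map_inlMap_eq_prodCone (C : PointedCone ℝ (Fin m₁ → ℝ)) :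
    C.map (inlMap m₁ m₂) = prodCone C ⊥ := by
  simp [prodCone_eq_sup, PointedCone.map]

theorem map_inrMap_eq_prodCone (C : PointedCone ℝ (Fin m₂ → ℝ)) :
    C.map (inrMap m₁ m₂) = prodCone ⊥ C := by
  simp [prodCone_eq_sup, PointedCone.map]

theorem isFaceOf_prodCone (h₁ : F₁.IsFaceOf C₁) (h₂ : F₂.IsFaceOf C₂) :
    (prodCone F₁ F₂).IsFaceOf (prodCone C₁ C₂) :=
  (h₁.comap _).inf (h₂.comap _)

/-- If `x + y = 0` with `x ≠ 0` and both in `C`, then `C` contains the line through `x`. -/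
theorem bot_isFaceOf (h : (C : ConvexCone ℝ (Fin m → ℝ)).Salient) :
    (⊥ : PointedCone ℝ (Fin m → ℝ)).IsFaceOf C := by
  refine .of_mem_of_add_mem_left bot_le fun {x y} hx hy hxy => ?_
  rw [Submodule.mem_bot] at hxy ⊢
  by_contra hx0
  refine h x hx hx0 ?_
  rwa [neg_eq_of_add_eq_zero_right hxy]

/-- Every face of a product cone is a product of faces. -/
theorem exists_faces_of_isFaceOf_prodCone {G : PointedCone ℝ (Fin (m₁ + m₂) → ℝ)}
    (hG : G.IsFaceOf (prodCone C₁ C₂)) :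
    ∃ (F₁ : PointedCone ℝ (Fin m₁ → ℝ)) (F₂ : PointedCone ℝ (Fin m₂ → ℝ)),
      F₁.IsFaceOf C₁ ∧ F₂.IsFaceOf C₂ ∧ G = prodCone F₁ F₂ := by
  have e₁ : (prodCone C₁ C₂).comap (inlMap m₁ m₂) = C₁ := by
    ext x; exact inlMap_mem_prodCone
  have e₂ : (prodCone C₁ C₂).comap (inrMap m₁ m₂) = C₂ := by
    ext x; exact inrMap_mem_prodCone
  refine ⟨G.comap (inlMap m₁ m₂), G.comap (inrMap m₁ m₂), e₁ ▸ hG.comap _, e₂ ▸ hG.comap _, ?_⟩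
  ext x
  rw [mem_prodCone, PointedCone.mem_comap, PointedCone.mem_comap]
  constructor
  · intro hx
    have hxC := hG.le hx
    rw [← inlMap_add_inrMap x] at hx
    -- Both components lie in the product cone, so a face containing their sum contains each of
    -- them.
    exact (hG.add_mem_iff_mem (inlMap_mem_prodCone.2 hxC.1) (inrMap_mem_prodCone.2 hxC.2)).1 hx
  · rintro ⟨h₁, h₂⟩
    rw [← inlMap_add_inrMap x]
    exact add_mem h₁ h₂

theorem extremeRays_prodCone (h₁ : (C₁ : ConvexCone ℝ (Fin m₁ → ℝ)).Salient)
    (h₂ : (C₂ : ConvexCone ℝ (Fin m₂ → ℝ)).Salient) :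
    extremeRays (prodCone C₁ C₂) =
      PointedCone.map (inlMap m₁ m₂) '' extremeRays C₁ ∪
        PointedCone.map (inrMap m₁ m₂) '' extremeRays C₂ := by
  ext G
  constructor
  · rintro ⟨hG, hdim⟩
    obtain ⟨F₁, F₂, hF₁, hF₂, rfl⟩ := exists_faces_of_isFaceOf_prodCone hG
    rw [dim_prodCone] at hdim
    obtain ⟨d₁, d₂⟩ | ⟨d₁, d₂⟩ : (dim F₁ = 1 ∧ dim F₂ = 0) ∨ (dim F₁ = 0 ∧ dim F₂ = 1) := by
      omega
    · exact .inl ⟨F₁, ⟨hF₁, d₁⟩, by rw [dim_eq_zero.1 d₂, map_inlMap_eq_prodCone]⟩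
    · exact .inr ⟨F₂, ⟨hF₂, d₂⟩, by rw [dim_eq_zero.1 d₁, map_inrMap_eq_prodCone]⟩
  · rintro (⟨F, ⟨hF, hdim⟩, rfl⟩ | ⟨F, ⟨hF, hdim⟩, rfl⟩)
    · refine ⟨?_, by rw [dim_map inlMap_injective, hdim]⟩
      rw [map_inlMap_eq_prodCone]
      exact isFaceOf_prodCone hF (bot_isFaceOf h₂)
    · refine ⟨?_, by rw [dim_map inrMap_injective, hdim]⟩
      rw [map_inrMap_eq_prodCone]
      exact isFaceOf_prodCone (bot_isFaceOf h₁) hF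

theorem map_injective_of_injective {n : ℕ} {f : (Fin m → ℝ) →ₗ[ℝ] (Fin n → ℝ)}
    (hf : Function.Injective f) : Function.Injective (PointedCone.map f) :=
  Submodule.map_injective_of_injective hf

theorem encard_extremeRays_prodCone (h₁ : (C₁ : ConvexCone ℝ (Fin m₁ → ℝ)).Salient)
    (h₂ : (C₂ : ConvexCone ℝ (Fin m₂ → ℝ)).Salient) :
    (extremeRays (prodCone C₁ C₂)).encard =
      (extremeRays C₁).encard + (extremeRays C₂).encard := by
  rw [extremeRays_prodCone h₁ h₂, Set.encard_union_eq,
    (map_injective_of_injective inlMap_injective).encard_image,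
    (map_injective_of_injective inrMap_injective).encard_image]
  rw [Set.disjoint_left]
  rintro _ ⟨F, ⟨-, hF⟩, rfl⟩ ⟨F', -, h⟩
  -- The two embedded coordinate spaces meet only in 0, so a cone lying in both has dimension 0, not
  -- 1.
  have : F = ⊥ := by
    rw [Submodule.eq_bot_iff]
    intro x hx
    obtain ⟨y, -, hy⟩ : inlMap m₁ m₂ x ∈ F'.map (inrMap m₁ m₂) := h ▸ ⟨x, hx, rfl⟩
    simpa using (congrArg (fstProj m₁ m₂) hy).symm
  rw [dim_eq_zero.2 this] at hF
  exact zero_ne_one hF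

end Product

end NumSgp

theorem theorem1p6 (S₁ S₂ : AddSubmonoid ℕ) :
    (∀ k₁ k₂ : ℕ, NumSgp.IsNormalescent k₁ S₁ → NumSgp.IsNormalescent k₂ S₂ →
      NumSgp.IsNormalescent (k₁ + k₂) (NumSgp.sum S₁ S₂)) ∧
    (∀ k₁ k₂ : ℕ, NumSgp.IsRayNormalescent k₁ S₁ → NumSgp.IsRayNormalescent k₂ S₂ →
      NumSgp.IsRayNormalescent (k₁ + k₂) (NumSgp.sum S₁ S₂)) ∧
    (∀ (m₁ m₂ : ℕ) (C₁ : PointedCone ℝ (Fin m₁ → ℝ)) (C₂ : PointedCone ℝ (Fin m₂ → ℝ))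
      (π₁ : (Fin m₁ → ℝ) →ₗ[ℝ] ℝ) (π₂ : (Fin m₂ → ℝ) →ₗ[ℝ] ℝ),
      NumSgp.IsProjection C₁ π₁ S₁ → NumSgp.IsProjection C₂ π₂ S₂ →
        NumSgp.IsProjection (NumSgp.prodCone C₁ C₂) (NumSgp.sumProj π₁ π₂) (NumSgp.sum S₁ S₂) ∧
        NumSgp.dim (NumSgp.prodCone C₁ C₂) = NumSgp.dim C₁ + NumSgp.dim C₂ ∧
        (NumSgp.extremeRays (NumSgp.prodCone C₁ C₂)).encard =
          (NumSgp.extremeRays C₁).encard + (NumSgp.extremeRays C₂).encard) ∧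
    (∀ k₁ k₂ : ℕ, NumSgp.IsKQuotient k₁ S₁ → NumSgp.IsKQuotient k₂ S₂ →
      NumSgp.IsKQuotient (k₁ + k₂) (NumSgp.sum S₁ S₂)) := by
  refine ⟨?_, ?_, ?_, fun _ _ h₁ h₂ => h₁.sum h₂⟩
  · rintro k₁ k₂ ⟨m₁, C₁, π₁, h₁, rfl⟩ ⟨m₂, C₂, π₂, h₂, rfl⟩
    exact ⟨_, _, _, h₁.prodCone h₂, NumSgp.dim_prodCone C₁ C₂⟩
  · rintro k₁ k₂ ⟨m₁, C₁, π₁, h₁, hk₁⟩ ⟨m₂, C₂, π₂, h₂, hk₂⟩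
    refine ⟨_, _, _, h₁.prodCone h₂, ?_⟩
    rw [NumSgp.encard_extremeRays_prodCone h₁.1.2 h₂.1.2, hk₁, hk₂, Nat.cast_add]
  · intro m₁ m₂ C₁ C₂ π₁ π₂ h₁ h₂
    exact ⟨h₁.prodCone h₂, NumSgp.dim_prodCone C₁ C₂,
      NumSgp.encard_extremeRays_prodCone h₁.1.2 h₂.1.2⟩
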